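/- Let $\mathbb F$ be a finite field and $n\ge 0$. Write $\mathbb F^n[[z,z^{-1}]]=(\mathbb F^n)^{\mathbb Z}$ for the space of two-sided sequences $w=\sum_{i\in\mathbb Z}w_iz^i$, with the metric $d(v,w)=\sum_{i\in\mathbb Z}2^{-|i|}d_H(v_i,w_i)$, where $d_H$ is the Hamming distance on $\mathbb F^n$, and regard $\mathbb F^n((z))$ (vectors of formal Laurent series) as a subset of it. Let $\sigma w=z^{-1}w$ be the left shift. A behavior is a subset $\mathcal B\subset\mathbb F^n[[z,z^{-1}]]$ that is linear over $\mathbb F$, time-invariant ($\sigma\mathcal B=\mathcal B$) and complete (if for every finite interval $J\subset\mathbb Z$ the restriction $w|_J$ is the restriction of an element of $\mathcal B$, then $w\in\mathcal B$). It is controllable if there is an integer $\ell$ (possibly negative) such that for all $w,w'\in\mathcal B$ and every integer $j$ there is $w''\in\mathcal B$ with $(z^jw'')^-=(z^jw)^-$ and $(z^{j+\ell}w'')^+=(z^{j+\ell}w')^+$, where $^-$ and $^+$ denote the parts of a sequence with indices $\le 0$ and $\ge 0$, respectively. A (Laurent series) convolutional code is an $\mathbb F((z))$-linear subspace of $\mathbb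 F^n((z))$ that has an $\mathbb F((z))$-basis consisting of rational vectors, i.e. vectors in $\mathbb F(z)^n$. Theorem. For every behavior $\mathcal B\subset\mathbb F^n[[z,z^{-1}]]$, the set $\mathcal C:=\mathcal B\cap\mathbb F^n((z))$ is a convolutional code, and its closure $\overline{\mathcal C}$ in $\mathbb F^n[[z,z^{-1}]]$ is the largest controllable behavior contained in $\mathcal B$. Moreover, $\mathcal B\mapsto\mathcal B\cap\mathbb F^n((z))$ is a bijection from the set of controllable behaviors in $\mathbb F^n[[z,z^{-1}]]$ onto the set of convolutional codes in $\mathbb F^n((z))$, with inverse $\mathcal C\mapsto\overline{\mathcal C}$. -/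

import Mathlib

open scoped LaurentSeries RatFunc

namespace ConvCode

noncomputable section

/-- The two-sided sequence space `F^n[[z, z⁻¹]] = (F^n)^ℤ`; the sequence `w` stands for the formal
sum `∑ i, w i * z ^ i`, and it is added and scaled coefficientwise. -/
def Seq (F : Type*) (n : ℕ) : Type _ := ℤ → Fin n → F

variable {F : Type*} {n : ℕ}

instance [Field F] : AddCommGroup (Seq F n) := inferInstanceAs (AddCommGroup (ℤ → Fin n → F))

instance [Field F] : Module F (Seq F n) := inferInstanceAs (Module F (ℤ → Fin n → F))

open Classical in
/-- The terms of the distance `d(v, w) = ∑ i, 2 ^ (-|i|) * d_H(v_i, w_i)`, where `d_H` is the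
Hamming distance on `F^n`. -/
def distTerm (v w : Seq F n) (i : ℤ) : ℝ := (1 / 2 : ℝ) ^ i.natAbs * (hammingDist (v i) (w i) : ℝ)

theorem distTerm_nonneg (v w : Seq F n) (i : ℤ) : 0 ≤ distTerm v w i := by
  unfold distTerm; positivity

theorem summable_distTerm (v w : Seq F n) : Summable (distTerm v w) := by
  classical
  have h : Summable fun i : ℤ => (1 / 2 : ℝ) ^ i.natAbs * (n : ℝ) := by
    refine Summable.mul_right _ (Summable.of_nat_of_neg ?_ ?_)
    · simpa using summable_geometric_two
    · simpa using summable_geometric_two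
  refine h.of_nonneg_of_le (distTerm_nonneg v w) fun i => ?_
  unfold distTerm
  refine mul_le_mul_of_nonneg_left ?_ (by positivity)
  have := hammingDist_le_card_fintype (x := v i) (y := w i)
  rw [Fintype.card_fin] at this
  exact_mod_cast this

/-- The metric `d(v, w) = ∑ i, 2 ^ (-|i|) * d_H(v_i, w_i)` on `F^n[[z, z⁻¹]]`. All topological
notions on `F^n[[z, z⁻¹]]` refer to it. -/
instance : MetricSpace (Seq F n) where
  dist v w := ∑' i : ℤ, distTerm v w i
  dist_self v := by simp [distTerm]
  dist_comm v w := by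
    classical
    refine tsum_congr fun i => ?_
    simp only [distTerm]
    rw [hammingDist_comm]
  dist_triangle u v w := by
    classical
    rw [← (summable_distTerm u v).tsum_add (summable_distTerm v w)]
    refine (summable_distTerm u w).tsum_le_tsum (fun i => ?_)
      ((summable_distTerm u v).add (summable_distTerm v w))
    unfold distTerm
    rw [← mul_add]
    refine mul_le_mul_of_nonneg_left ?_ (by positivity)
    exact_mod_cast hammingDist_triangle _ _ _
  eq_of_dist_eq_zero := by
    intro v w h
    have h0 := (hasSum_zero_iff_of_nonneg (distTerm_nonneg v w)).1
      (h ▸ (summable_distTerm v w).hasSum)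
    funext i
    have hi := congrFun h0 i
    simpa [distTerm] using hi

/-- The left shift `σ w(z) = z⁻¹ w(z)`, i.e. `(σ w)_i = w_{i+1}`. -/
def shift (w : Seq F n) : Seq F n := fun i => w (i + 1)

/-- Multiplication by `z ^ j`: the coefficient of `z ^ j * w(z)` at `z ^ i` is `w_{i-j}`. -/
def zpowMul (j : ℤ) (w : Seq F n) : Seq F n := fun i => w (i - j)

/-- `B` is linear: it is the underlying set of an `F`-linear subspace. -/
def IsLinear [Field F] (B : Set (Seq F n)) : Prop :=
  ∃ S : Submodule F (Seq F n), (S : Set (Seq F n)) = B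

/-- Time-invariance on the time axis `ℤ`: `σ B = B`. -/
def IsTimeInvariant (B : Set (Seq F n)) : Prop := shift '' B = B

/-- `B` is complete: a sequence `w` belongs to `B` as soon as for every finite interval
`J = [a, b]` of `ℤ` its restriction to `J` is the restriction of an element of `B`. -/
def IsCompleteBehavior (B : Set (Seq F n)) : Prop :=
  ∀ w : Seq F n, (∀ a b : ℤ, ∃ v ∈ B, ∀ i ∈ Set.Icc a b, v i = w i) → w ∈ B

/-- Linear, time-invariant, complete behaviors in `F^n[[z, z⁻¹]]`. -/
structure IsBehavior [Field F] (B : Set (Seq F n)) : Prop where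
  linear : IsLinear B
  timeInvariant : IsTimeInvariant B
  complete : IsCompleteBehavior B

/-- `B` is controllable: there is an integer `ℓ` such that for all `w, w' ∈ B` and all integers `j`
there is `w'' ∈ B` with `(z^j w'')⁻ = (z^j w)⁻` and `(z^(j+ℓ) w'')⁺ = (z^(j+ℓ) w')⁺`, where
`⁻` keeps the coefficients of index `≤ 0` and `⁺` those of index `≥ 0`.
So `w''` agrees with `w` up to time `-j` and with `w'` from time `-j - ℓ` on; the integer `ℓ` may
be negative, and then there is a gap of length `-ℓ` to steer from `w` to `w'`. -/
def IsControllable (B : Set (Seq F n)) : Prop :=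
  ∃ l : ℤ, ∀ w ∈ B, ∀ w' ∈ B, ∀ j : ℤ, ∃ w'' ∈ B,
    (∀ i : ℤ, i ≤ 0 → zpowMul j w'' i = zpowMul j w i) ∧
    (∀ i : ℤ, 0 ≤ i → zpowMul (j + l) w'' i = zpowMul (j + l) w' i)

/-- Controllable (linear, time-invariant, complete) behaviors. -/
structure IsControllableBehavior [Field F] (B : Set (Seq F n)) : Prop extends IsBehavior B where
  controllable : IsControllable B

/-- The embedding `F^n((z)) → F^n[[z, z⁻¹]]` that sends a vector of Laurent series to its sequence
of coefficient vectors. -/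
def laurentToSeq [Field F] (c : Fin n → F⸨X⸩) : Seq F n := fun i a => (c a).coeff i

/-- `B ∩ F^n((z))`, as a subset of `F^n((z))`. -/
def laurentPart [Field F] (B : Set (Seq F n)) : Set (Fin n → F⸨X⸩) := laurentToSeq ⁻¹' B

/-- The closure in `F^n[[z, z⁻¹]]` of a subset of `F^n((z))`. -/
def laurentClosure [Field F] (C : Set (Fin n → F⸨X⸩)) : Set (Seq F n) := closure (laurentToSeq '' C)

/-- Laurent series convolutional codes: `F((z))`-linear subspaces of `F^n((z))` that have a basis
of rational vectors, i.e. of vectors in `F^n(z)`. -/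
def IsConvolutionalCode [Field F] (C : Set (Fin n → F⸨X⸩)) : Prop :=
  ∃ S : Submodule F⸨X⸩ (Fin n → F⸨X⸩), (S : Set (Fin n → F⸨X⸩)) = C ∧
    ∃ (k : ℕ) (b : Module.Basis (Fin k) F⸨X⸩ S), ∀ (i : Fin k) (a : Fin n),
      ∃ r : RatFunc F, (b i : Fin n → F⸨X⸩) a = algebraMap (RatFunc F) F⸨X⸩ r

end

end ConvCode

/-!
Both behaviors and convolutional codes are solution sets of polynomial equations, and this is what
makes them correspond.

A behavior `B` is the set `seqKernel M` of the sequences `w` with `∑ a, p a * w a = 0` for all `p`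
in some set `M` of polynomial vectors: since `B` is complete, a sequence outside of `B` is detected
on a finite window, and there by a linear functional, that is, by a polynomial vector
(`IsBehavior.exists_eq_seqKernel`). Hence `B ∩ F^n((z))` is the set `laurentKernel M` of solutions of
the same equations over `F((z))`. Expanding such a solution in a basis of `F((z))` over `F(z)`
exhibits it as a combination of rational solutions, so that `B ∩ F^n((z))` is a convolutional code
(`isConvolutionalCode_laurentKernel`). Conversely the double annihilator theorem over `F(z)` and the
same expansion show that every convolutional code `C` is of the form `laurentKernel M`
(`IsConvolutionalCode.exists_eq_laurentKernel`). The set `seqKernel M` is closed, so it contains the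
closure of `C`, and the closure of `C` acquires no new Laurent series.

A code `C` is controllable because it is spanned by finitely many polynomial vectors: concatenating
the coefficients of two code words concatenates the code words, up to a delay bounded by the degrees
of the generators. As `F` is finite, the sequence space is compact, and the same delay works for the
closure of `C` (`IsControllable.closure`). Finally, a controllable behavior is the closure of its
Laurent part: steering from the zero trajectory to `w` at earlier and earlier times approximates `w`
by elements of the behavior that vanish in the far past.
-/

open scoped LaurentSeries RatFunc

namespace ConvCode

open Polynomial

variable {F : Type*} {n : ℕ}

/-! ### The topology of the sequence space -/

section Topology

variable [Finite F]

/-- Over a finite alphabet the metric of `Seq F n` induces the product of the discrete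
topologies. The identity map out of the product is continuous because the metric is a uniformly
convergent series of locally constant functions; as the product is compact, this suffices. -/
theorem exists_homeomorph_pi [TopologicalSpace F] [DiscreteTopology F] :
    ∃ e : (ℤ → Fin n → F) ≃ₜ Seq F n, ∀ w, e w = w := by
  let f : (ℤ → Fin n → F) ≃ Seq F n := Equiv.refl (ℤ → Fin n → F)
  have hc : Continuous f := by
    refine continuous_iff_continuous_dist.2 ?_
    have hs : Summable fun i : ℤ => (1 / 2 : ℝ) ^ i.natAbs * (n : ℝ) := by
      refine Summable.mul_right _ (Summable.of_nat_of_neg ?_ ?_) <;>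
        simpa using summable_geometric_two
    refine continuous_tsum (fun i => ?_) hs fun i x => ?_
    · have h1 : Continuous fun x : (ℤ → Fin n → F) × (ℤ → Fin n → F) => (x.1 i, x.2 i) := by
        fun_prop
      classical
      exact (continuous_of_discreteTopology
        (f := fun y : (Fin n → F) × (Fin n → F) =>
          (1 / 2 : ℝ) ^ i.natAbs * (hammingDist y.1 y.2 : ℝ))).comp h1 |>.congr fun x => by
            simp only [distTerm, Function.comp]
            congr!
    · rw [Real.norm_of_nonneg (distTerm_nonneg _ _ _)]
      unfold distTerm
      refine mul_le_mul_of_nonneg_left ?_ (by positivity)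
      classical
      have := hammingDist_le_card_fintype (x := x.1 i) (y := x.2 i)
      rw [Fintype.card_fin] at this
      refine le_trans (le_of_eq ?_) (Nat.cast_le.2 this)
      congr!
  exact ⟨hc.homeoOfEquivCompactToT2, fun w => rfl⟩

theorem compactSpace_seq : CompactSpace (Seq F n) := by
  let _ : TopologicalSpace F := ⊥
  have : DiscreteTopology F := ⟨rfl⟩
  obtain ⟨e, -⟩ := exists_homeomorph_pi (F := F) (n := n)
  exact e.compactSpace

theorem isClopen_setOf_apply_eq (i : ℤ) : IsClopen {x : Seq F n × Seq F n | x.1 i = x.2 i} := by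
  let _ : TopologicalSpace F := ⊥
  have : DiscreteTopology F := ⟨rfl⟩
  obtain ⟨e, he⟩ := exists_homeomorph_pi (F := F) (n := n)
  have h : Continuous fun w : Seq F n => w i := by
    refine ((continuous_apply i).comp e.symm.continuous).congr fun w => ?_
    conv_rhs => rw [← e.apply_symm_apply w, he]
    rfl
  exact (isClopen_discrete {y : (Fin n → F) × (Fin n → F) | y.1 = y.2}).preimage
    ((h.comp continuous_fst).prodMk (h.comp continuous_snd))

/-- A sequence is in the closure of `A` exactly if on each finite window it agrees with an element
of `A`. -/
theorem mem_closure_iff_forall_Icc {A : Set (Seq F n)} {w : Seq F n} :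
    w ∈ closure A ↔ ∀ a b : ℤ, ∃ v ∈ A, ∀ i ∈ Set.Icc a b, v i = w i := by
  constructor
  · intro hw a b
    have ho : IsOpen (⋂ i ∈ Set.Icc a b, {v : Seq F n | v i = w i}) :=
      (Set.finite_Icc a b).isOpen_biInter fun i _ =>
        (isClopen_setOf_apply_eq i).isOpen.preimage (Continuous.prodMk_left w)
    obtain ⟨v, hv, hvA⟩ := mem_closure_iff.1 hw _ ho (by simp)
    exact ⟨v, hvA, fun i hi => by simpa using Set.mem_iInter₂.1 hv i hi⟩
  · intro h
    let _ : TopologicalSpace F := ⊥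
    have : DiscreteTopology F := ⟨rfl⟩
    obtain ⟨e, he⟩ := exists_homeomorph_pi (F := F) (n := n)
    refine mem_closure_iff.2 fun U hU hwU => ?_
    obtain ⟨I, u, hu, hIU⟩ := isOpen_pi_iff.1 (hU.preimage e.continuous) w
      (show e w ∈ U from (he w).symm ▸ hwU)
    obtain ⟨a, ha⟩ := I.bddBelow
    obtain ⟨b, hb⟩ := I.bddAbove
    obtain ⟨v, hv, hvw⟩ := h a b
    have : e v ∈ U := hIU fun i hi => by
      rw [hvw i ⟨ha hi, hb hi⟩]
      exact (hu i hi).2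
    exact ⟨v, he v ▸ this, hv⟩

theorem isCompleteBehavior_closure (A : Set (Seq F n)) : IsCompleteBehavior (closure A) := by
  intro w h
  rw [← closure_closure]
  exact mem_closure_iff_forall_Icc.2 h

theorem closure_subset_of_isCompleteBehavior {A B : Set (Seq F n)} (hB : IsCompleteBehavior B)
    (h : A ⊆ B) : closure A ⊆ B := fun _ hw =>
  hB _ fun a b => let ⟨v, hv, hvw⟩ := mem_closure_iff_forall_Icc.1 hw a b
  ⟨v, h hv, hvw⟩

/-- Controllability passes to closures: by compactness, the pairs `(w, w')` that can be
concatenated at a given time within the closure form a closed set. -/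
theorem IsControllable.closure {A : Set (Seq F n)} (hA : IsControllable A) :
    IsControllable (closure A) := by
  have := compactSpace_seq (F := F) (n := n)
  obtain ⟨l, hl⟩ := hA
  refine ⟨l, fun w hw w' hw' j => ?_⟩
  let T : Set ((Seq F n × Seq F n) × Seq F n) :=
    {x | x.2 ∈ _root_.closure A} ∩
      ((⋂ i : ℤ, ⋂ _ : i ≤ 0, {x | zpowMul j x.2 i = zpowMul j x.1.1 i}) ∩
      ⋂ i : ℤ, ⋂ _ : 0 ≤ i, {x | zpowMul (j + l) x.2 i = zpowMul (j + l) x.1.2 i})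
  have hT : IsClosed T := by
    refine (isClosed_closure.preimage continuous_snd).inter (IsClosed.inter ?_ ?_)
    · exact isClosed_iInter fun i => isClosed_iInter fun _ =>
        (isClopen_setOf_apply_eq (i - j)).isClosed.preimage
          (continuous_snd.prodMk (continuous_fst.comp continuous_fst))
    · exact isClosed_iInter fun i => isClosed_iInter fun _ =>
        (isClopen_setOf_apply_eq (i - (j + l))).isClosed.preimage
          (continuous_snd.prodMk (continuous_snd.comp continuous_fst))
  have hP : IsClosed (Prod.fst '' T) := (hT.isCompact.image continuous_fst).isClosed
  have hsub : A ×ˢ A ⊆ Prod.fst '' T := by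
    rintro ⟨v, v'⟩ ⟨hv, hv'⟩
    obtain ⟨v'', h, h1, h2⟩ := hl v hv v' hv' j
    exact ⟨((v, v'), v''), ⟨subset_closure h, by simpa using h1, by simpa using h2⟩, rfl⟩
  have hmem : (w, w') ∈ Prod.fst '' T := by
    refine closure_minimal hsub hP ?_
    rw [closure_prod_eq]
    exact ⟨hw, hw'⟩
  obtain ⟨⟨⟨_, _⟩, w''⟩, ⟨h, h1, h2⟩, he⟩ := hmem
  obtain ⟨rfl, rfl⟩ := Prod.mk.inj he
  exact ⟨w'', h, by simpa using h1, by simpa using h2⟩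

end Topology

/-! ### Time-invariance -/

/-- The translate of `w` by `m` time steps, `z ^ (-m) * w`. -/
def translate (m : ℤ) (w : Seq F n) : Seq F n := fun i => w (i + m)

theorem translate_zero (w : Seq F n) : translate 0 w = w := by
  funext i
  rw [translate, add_zero]

theorem isTimeInvariant_iff {B : Set (Seq F n)} :
    IsTimeInvariant B ↔ ∀ m : ℤ, ∀ w ∈ B, translate m w ∈ B := by
  constructor
  · intro h m
    induction m with
    | zero => intro w hw; rwa [translate_zero]
    | succ m ih =>
      intro w hw
      rw [← h]
      refine ⟨_, ih w hw, funext fun i => ?_⟩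
      simp only [shift, translate]
      congr 1
      ring
    | pred m ih =>
      intro w hw
      obtain ⟨v, hv, rfl⟩ := h.ge hw
      convert ih v hv using 1
      funext i
      simp only [shift, translate]
      congr 1
      ring
  · intro h
    refine Set.Subset.antisymm ?_ fun w hw => ⟨translate (-1) w, h _ w hw, ?_⟩
    · rintro _ ⟨w, hw, rfl⟩
      exact h 1 w hw
    · funext i
      simp [shift, translate]

/-! ### Polynomial equations over Laurent series -/

section Kernel

variable [Field F]

/-- The solutions in `F((z))^n` of the linear equations `∑ a, p a * c a = 0`, for `p` in a set `M`
of polynomial vectors. -/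
def laurentKernel (M : Set (Fin n → F[X])) : Submodule F⸨X⸩ (Fin n → F⸨X⸩) where
  carrier := {c | ∀ p ∈ M, ∑ a, algebraMap F[X] F⸨X⸩ (p a) * c a = 0}
  zero_mem' p _ := by simp
  add_mem' {c d} hc hd p hp := by
    simp only [Pi.add_apply, mul_add, Finset.sum_add_distrib, hc p hp, hd p hp, add_zero]
  smul_mem' s c hc p hp := by
    simp only [Pi.smul_apply, smul_eq_mul, mul_left_comm _ s, ← Finset.mul_sum, hc p hp, mul_zero]

/-- A vector is in the span over the larger field as soon as the vectors of its coordinates with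
respect to a basis of the field extension are in the span over the smaller field. -/
theorem mem_span_image_algebraMap {K L ι : Type*} [Field K] [Field L] [Algebra K L]
    {W : Submodule K (Fin n → K)} (e : Module.Basis ι K L) {c : Fin n → L}
    (h : ∀ i, (fun a => e.repr (c a) i) ∈ W) :
    c ∈ Submodule.span L ((fun x a => algebraMap K L (x a)) '' (W : Set (Fin n → K))) := by
  classical
  let s : Finset ι := Finset.univ.biUnion fun a => (e.repr (c a)).support
  have hc : c = ∑ i ∈ s, e i • fun a => algebraMap K L (e.repr (c a) i) := by
    funext a
    rw [Finset.sum_apply]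
    conv_lhs => rw [← e.linearCombination_repr (c a), Finsupp.linearCombination_apply,
      Finsupp.sum_of_support_subset _
        (Finset.subset_biUnion_of_mem (fun a => (e.repr (c a)).support) (Finset.mem_univ a)) _
        (by simp)]
    refine Finset.sum_congr rfl fun i _ => ?_
    rw [Algebra.smul_def, mul_comm]
    rfl
  rw [hc]
  exact Submodule.sum_mem _ fun i _ => Submodule.smul_mem _ _ (Submodule.subset_span ⟨_, h i, rfl⟩)

/-- Coordinates with respect to an `F(z)`-basis of `F((z))` of a solution of a polynomial equation
are themselves solutions. -/
theorem sum_mul_repr_eq_zero {ι : Type*} (e : Module.Basis ι (RatFunc F) F⸨X⸩) {p : Fin n → F[X]}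
    {c : Fin n → F⸨X⸩} (h : ∑ a, algebraMap F[X] F⸨X⸩ (p a) * c a = 0) (i : ι) :
    ∑ a, algebraMap F[X] (RatFunc F) (p a) * e.repr (c a) i = 0 := by
  have h' : ∑ a, algebraMap F[X] (RatFunc F) (p a) • c a = 0 := by
    rw [← h]
    refine Finset.sum_congr rfl fun a _ => ?_
    rw [Algebra.smul_def, ← IsScalarTower.algebraMap_apply F[X] (RatFunc F) F⸨X⸩]
  have := congrArg (fun x => e.repr x i) h'
  simpa only [map_sum, map_smul, Finsupp.finsetSum_apply, Finsupp.smul_apply, smul_eq_mul,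
    map_zero, Finsupp.zero_apply] using this

/-- Solution spaces of polynomial equations are convolutional codes: expanding a solution in an
`F(z)`-basis of `F((z))` writes it as a combination of rational solutions. -/
theorem isConvolutionalCode_laurentKernel (M : Set (Fin n → F[X])) :
    IsConvolutionalCode (laurentKernel M : Set (Fin n → F⸨X⸩)) := by
  let W : Submodule (RatFunc F) (Fin n → RatFunc F) :=
    { carrier := {x | ∀ p ∈ M, ∑ a, algebraMap F[X] (RatFunc F) (p a) * x a = 0}
      zero_mem' := fun p _ => by simp
      add_mem' := fun {c d} hc hd p hp => by
        simp [mul_add, Finset.sum_add_distrib, hc p hp, hd p hp]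
      smul_mem' := fun s c hc p hp => by
        simp only [Pi.smul_apply, smul_eq_mul, mul_left_comm _ s, ← Finset.mul_sum, hc p hp,
          mul_zero] }
  let T : Set (Fin n → F⸨X⸩) :=
    (fun x a => algebraMap (RatFunc F) F⸨X⸩ (x a)) '' (W : Set (Fin n → RatFunc F))
  have hspan : laurentKernel M = Submodule.span F⸨X⸩ T := by
    apply le_antisymm
    · intro c hc
      exact mem_span_image_algebraMap (Module.Basis.ofVectorSpace (RatFunc F) F⸨X⸩)
        fun i p hp => sum_mul_repr_eq_zero _ (hc p hp) i
    · refine Submodule.span_le.2 ?_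
      rintro _ ⟨x, hx, rfl⟩ p hp
      have := congrArg (algebraMap (RatFunc F) F⸨X⸩) (hx p hp)
      simpa [map_sum, map_mul, ← IsScalarTower.algebraMap_apply F[X] (RatFunc F) F⸨X⸩] using this
  obtain ⟨t, htT, ht, hli⟩ := exists_linearIndependent F⸨X⸩ T
  have : Finite t := hli.finite
  let b := (Module.Basis.span hli).map
    (LinearEquiv.ofEq _ (laurentKernel M) (by rw [Subtype.range_coe, ht, hspan]))
  let ε := Finite.equivFin t
  refine ⟨laurentKernel M, rfl, Nat.card t, b.reindex ε, fun i a => ?_⟩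
  obtain ⟨x, -, hx⟩ := htT (ε.symm i).2
  refine ⟨x a, ?_⟩
  have hb : ((b.reindex ε i : laurentKernel M) : Fin n → F⸨X⸩) = (ε.symm i : Fin n → F⸨X⸩) := by
    rw [Module.Basis.reindex_apply, Module.Basis.map_apply, LinearEquiv.coe_ofEq_apply,
      Module.Basis.span_apply]
  rw [hb, ← hx]

/-- A common denominator turns a rational vector into a polynomial one. -/
theorem exists_polynomial_multiple (x : Fin n → RatFunc F) :
    ∃ q : RatFunc F, q ≠ 0 ∧ ∃ p : Fin n → F[X], ∀ a, algebraMap F[X] (RatFunc F) (p a) = q * x a := by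
  obtain ⟨q, hq⟩ := IsLocalization.exist_integer_multiples_of_finite (nonZeroDivisors F[X]) x
  choose p hp using hq
  refine ⟨algebraMap F[X] (RatFunc F) q, ?_, p, fun a => ?_⟩
  · exact IsFractionRing.to_map_ne_zero_of_mem_nonZeroDivisors q.2
  · rw [hp a, Algebra.smul_def]

/-- Every convolutional code is cut out by polynomial equations, by the double annihilator theorem
over `F(z)` and expansion in an `F(z)`-basis of `F((z))`. -/
theorem IsConvolutionalCode.exists_eq_laurentKernel {C : Set (Fin n → F⸨X⸩)}
    (hC : IsConvolutionalCode C) :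
    ∃ M : Set (Fin n → F[X]), C = (laurentKernel M : Set (Fin n → F⸨X⸩)) := by
  obtain ⟨S, rfl, k, b, hb⟩ := hC
  choose r hr using hb
  let M : Set (Fin n → F[X]) :=
    {p | ∀ t, ∑ a, algebraMap F[X] (RatFunc F) (p a) * r t a = 0}
  have hbM : ∀ t, (b t : Fin n → F⸨X⸩) ∈ laurentKernel M := fun t p hp => by
    have := congrArg (algebraMap (RatFunc F) F⸨X⸩) (hp t)
    simpa [map_sum, map_mul, ← IsScalarTower.algebraMap_apply F[X] (RatFunc F) F⸨X⸩, ← hr]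
      using this
  refine ⟨M, congrArg _ (le_antisymm (fun c hc => ?_) fun c hc => ?_)⟩
  · have := congrArg Subtype.val (b.sum_repr ⟨c, hc⟩)
    rw [← show _ = c from this, Submodule.coe_sum]
    exact Submodule.sum_mem _ fun t _ => Submodule.smul_mem _ _ (hbM t)
  · let W := Submodule.span (RatFunc F) (Set.range r)
    have hW : Submodule.span F⸨X⸩
        ((fun x a => algebraMap (RatFunc F) F⸨X⸩ (x a)) '' (W : Set (Fin n → RatFunc F))) ≤ S := by
      refine Submodule.span_le.2 ?_
      rintro _ ⟨x, hx, rfl⟩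
      simp only [SetLike.mem_coe]
      induction hx using Submodule.span_induction with
      | mem x hx =>
        obtain ⟨t, rfl⟩ := hx
        have : (fun a => algebraMap (RatFunc F) F⸨X⸩ (r t a)) = (b t : Fin n → F⸨X⸩) :=
          funext fun a => (hr t a).symm
        rw [this]
        exact (b t).2
      | zero => convert S.zero_mem using 1; ext; simp
      | add x y _ _ hx hy => convert S.add_mem hx hy using 1; ext; simp
      | smul s x _ hx => convert S.smul_mem (algebraMap (RatFunc F) F⸨X⸩ s) hx using 1; ext; simp
    refine hW (mem_span_image_algebraMap (Module.Basis.ofVectorSpace (RatFunc F) F⸨X⸩) fun i => ?_)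
    by_contra hi
    obtain ⟨f, hf, hWf⟩ := Submodule.exists_le_ker_of_notMem hi
    obtain ⟨q, hq, p, hp⟩ :=
      exists_polynomial_multiple fun a => f fun j => if a = j then 1 else 0
    have hpf : ∀ x, ∑ a, algebraMap F[X] (RatFunc F) (p a) * x a = q * f x := fun x => by
      rw [LinearMap.pi_apply_eq_sum_univ f x, Finset.mul_sum]
      refine Finset.sum_congr rfl fun a _ => ?_
      rw [hp, smul_eq_mul]
      ring
    have hpM : p ∈ M := fun t => by
      rw [hpf, show f (r t) = 0 from hWf (Submodule.subset_span ⟨t, rfl⟩), mul_zero]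
    have h0 := sum_mul_repr_eq_zero (Module.Basis.ofVectorSpace (RatFunc F) F⸨X⸩) (hc p hpM) i
    rw [hpf] at h0
    exact (mul_ne_zero hq hf) h0

/-- A convolutional code is spanned by finitely many polynomial vectors. -/
theorem IsConvolutionalCode.exists_polynomial_generators {C : Set (Fin n → F⸨X⸩)}
    (hC : IsConvolutionalCode C) :
    ∃ (k : ℕ) (g : Fin k → Fin n → F[X]),
      C = {c | ∃ s : Fin k → F⸨X⸩, ∀ a, c a = ∑ t, algebraMap F[X] F⸨X⸩ (g t a) * s t} := by
  obtain ⟨S, rfl, k, b, hb⟩ := hC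
  choose r hr using hb
  choose q hq g hg using fun t => exists_polynomial_multiple (r t)
  have hgb : ∀ t a, algebraMap F[X] F⸨X⸩ (g t a) =
      algebraMap (RatFunc F) F⸨X⸩ (q t) * (b t : Fin n → F⸨X⸩) a := fun t a => by
    rw [IsScalarTower.algebraMap_apply F[X] (RatFunc F) F⸨X⸩, hg, map_mul, hr]
  have hq' : ∀ t, algebraMap (RatFunc F) F⸨X⸩ (q t) ≠ 0 := fun t => by simpa using hq t
  refine ⟨k, g, Set.ext fun c => ⟨fun hc => ?_, ?_⟩⟩
  · refine ⟨fun t => (algebraMap (RatFunc F) F⸨X⸩ (q t))⁻¹ * b.repr ⟨c, hc⟩ t, fun a => ?_⟩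
    have h := congrFun (congrArg Subtype.val (b.sum_repr ⟨c, hc⟩)) a
    rw [Submodule.coe_sum, Finset.sum_apply] at h
    rw [← show _ = c a from h]
    refine Finset.sum_congr rfl fun t _ => ?_
    rw [hgb]
    have := hq' t
    simp only [Submodule.coe_smul, Pi.smul_apply, smul_eq_mul]
    field_simp
  · rintro ⟨s, hs⟩
    have : c = ∑ t, (s t * algebraMap (RatFunc F) F⸨X⸩ (q t)) • (b t : Fin n → F⸨X⸩) := by
      funext a
      rw [hs, Finset.sum_apply]
      refine Finset.sum_congr rfl fun t _ => ?_
      rw [hgb, Pi.smul_apply, smul_eq_mul]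
      ring
    rw [this]
    exact Submodule.sum_mem _ fun t _ => Submodule.smul_mem _ _ (b t).2

end Kernel

/-! ### Polynomial equations over sequences -/

section SeqKernel

variable [Field F]

/-- The coefficient of `z ^ i` in the product of a polynomial and a scalar two-sided sequence `u`,
as a linear function of the polynomial. -/
noncomputable def convCoeff (u : ℤ → F) (i : ℤ) : F[X] →ₗ[F] F :=
  lsum fun k => LinearMap.toSpanSingleton F F (u (i - k))

theorem convCoeff_monomial (u : ℤ → F) (i : ℤ) (k : ℕ) (r : F) :
    convCoeff u i (monomial k r) = r * u (i - k) := by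
  simp [convCoeff, lsum_apply, sum_monomial_index]

/-- The product of a polynomial of degree `d` with `u` at time `i` only depends on `u` at the times
from `i - d` to `i`. -/
theorem convCoeff_congr {p : F[X]} {u v : ℤ → F} {i : ℤ}
    (h : ∀ j, i - p.natDegree ≤ j → j ≤ i → u j = v j) : convCoeff u i p = convCoeff v i p := by
  simp only [convCoeff, lsum_apply, sum_def]
  refine Finset.sum_congr rfl fun k hk => ?_
  have := le_natDegree_of_mem_supp k hk
  rw [h (i - k) (by omega) (by omega)]

theorem algebraMap_monomial_eq_single (k : ℕ) (r : F) :
    algebraMap F[X] F⸨X⸩ (monomial k r) = HahnSeries.single (k : ℤ) r := by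
  rw [← C_mul_X_pow_eq_monomial]
  simp

theorem coeff_algebraMap_mul (p : F[X]) (s : F⸨X⸩) (i : ℤ) :
    (algebraMap F[X] F⸨X⸩ p * s).coeff i = convCoeff s.coeff i p := by
  induction p using Polynomial.induction_on' with
  | add p q hp hq => rw [map_add, add_mul, HahnSeries.coeff_add, hp, hq, map_add]
  | monomial k r =>
    rw [algebraMap_monomial_eq_single, HahnSeries.coeff_single_mul, convCoeff_monomial]

/-- The sequences solving the polynomial equations `∑ a, p a * w a = 0`, for `p ∈ M`. -/
def seqKernel (M : Set (Fin n → F[X])) : Set (Seq F n) :=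
  {w | ∀ p ∈ M, ∀ i, ∑ a, convCoeff (fun j => w j a) i (p a) = 0}

theorem laurentPart_seqKernel (M : Set (Fin n → F[X])) :
    laurentPart (seqKernel M) = (laurentKernel M : Set (Fin n → F⸨X⸩)) := by
  ext c
  refine forall₂_congr fun p _ => ?_
  rw [HahnSeries.ext_iff, funext_iff]
  refine forall_congr' fun i => ?_
  rw [HahnSeries.coeff_sum]
  simp only [coeff_algebraMap_mul]
  rfl

theorem isCompleteBehavior_seqKernel (M : Set (Fin n → F[X])) :
    IsCompleteBehavior (seqKernel M) := by
  intro w h p hp i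
  obtain ⟨v, hv, hvw⟩ := h (i - (Finset.univ.sup fun a => (p a).natDegree : ℕ)) i
  rw [← hv p hp i]
  refine Finset.sum_congr rfl fun a _ => convCoeff_congr fun j hj hji => ?_
  have : (p a).natDegree ≤ Finset.univ.sup fun a => (p a).natDegree :=
    Finset.le_sup (f := fun a => (p a).natDegree) (Finset.mem_univ a)
  rw [hvw j ⟨by omega, hji⟩]

/-- Every behavior is the solution set of polynomial equations. If the restriction of `w` to the
window `[a, b]` is not the restriction of an element of the behavior, a functional on the window
separates it; read as a polynomial vector, with time reversed, this functional gives an equation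
which holds on the behavior by time-invariance and fails for `w` at time `b`. -/
theorem IsBehavior.exists_eq_seqKernel {B : Set (Seq F n)} (hB : IsBehavior B) :
    ∃ M : Set (Fin n → F[X]), B = seqKernel M := by
  obtain ⟨⟨S, rfl⟩, hT, hC⟩ := hB
  rw [isTimeInvariant_iff] at hT
  let M : Set (Fin n → F[X]) :=
    {p | ∀ v ∈ S, ∀ i, ∑ a, convCoeff (fun j => v j a) i (p a) = 0}
  refine ⟨M, Set.Subset.antisymm (fun v hv p hp => hp v hv) fun w hw => hC w fun a b => ?_⟩
  let R : Seq F n →ₗ[F] (Set.Icc a b × Fin n → F) :=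
    { toFun := fun v x => v x.1 x.2
      map_add' := fun _ _ => rfl
      map_smul' := fun _ _ => rfl }
  by_contra hno
  have hw' : R w ∉ S.map R := by
    rintro ⟨v, hv, hvw⟩
    exact hno ⟨v, hv, fun i hi => funext fun c => congrFun hvw (⟨i, hi⟩, c)⟩
  obtain ⟨f, hf, hSf⟩ := Submodule.exists_le_ker_of_notMem hw'
  let p : Fin n → F[X] := fun c =>
    ∑ i : Set.Icc a b, monomial (b - i).toNat (f fun y => if (i, c) = y then 1 else 0)
  have hp : ∀ (v : Seq F n) (j : ℤ), ∑ c, convCoeff (fun j => v j c) j (p c) =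
      f (R (translate (j - b) v)) := fun v j => by
    rw [LinearMap.pi_apply_eq_sum_univ f, Fintype.sum_prod_type_right]
    refine Finset.sum_congr rfl fun c _ => ?_
    rw [map_sum]
    refine Finset.sum_congr rfl fun i _ => ?_
    rw [convCoeff_monomial, smul_eq_mul, mul_comm]
    have hi := i.2.2
    have : j - ((b - i).toNat : ℤ) = i + (j - b) := by
      rw [Int.toNat_of_nonneg (by omega)]
      ring
    rw [this]
    rfl
  have hpM : p ∈ M := fun v hv i => by
    rw [hp]
    exact hSf ⟨_, hT _ v hv, rfl⟩
  have h0 := hw p hpM b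
  rw [hp, sub_self, translate_zero] at h0
  exact hf h0

end SeqKernel

/-! ### Codes and their closures -/

section Code

variable [Field F]

/-- Concatenation at time `m`: the coefficients of index at most `m` come from `s`, the others
from `t`. -/
theorem exists_laurentSeries_splice (s t : F⸨X⸩) (m : ℤ) :
    ∃ u : F⸨X⸩, (∀ i ≤ m, u.coeff i = s.coeff i) ∧ ∀ i, m < i → u.coeff i = t.coeff i := by
  refine ⟨⟨fun i => if i ≤ m then s.coeff i else t.coeff i,
    (s.isPWO_support.union t.isPWO_support).mono fun i hi => ?_⟩, fun i hi => if_pos hi,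
    fun i hi => if_neg hi.not_ge⟩
  by_cases h : i ≤ m
  · exact Or.inl (by simpa [h] using hi)
  · exact Or.inr (by simpa [h] using hi)

/-- Concatenating coefficients with respect to polynomial generators concatenates code words, up to
a transition period bounded by the degrees of the generators. -/
theorem IsConvolutionalCode.isControllable {C : Set (Fin n → F⸨X⸩)} (hC : IsConvolutionalCode C) :
    IsControllable (laurentToSeq '' C) := by
  obtain ⟨k, g, rfl⟩ := hC.exists_polynomial_generators
  let d : ℕ := Finset.univ.sup fun x : Fin k × Fin n => (g x.1 x.2).natDegree
  have hd : ∀ t a, (g t a).natDegree ≤ d := fun t a =>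
    Finset.le_sup (f := fun x : Fin k × Fin n => (g x.1 x.2).natDegree) (Finset.mem_univ (t, a))
  refine ⟨-(d + 1), ?_⟩
  rintro _ ⟨c, ⟨s, hs⟩, rfl⟩ _ ⟨c', ⟨s', hs'⟩, rfl⟩ j
  choose u hu hu' using fun t => exists_laurentSeries_splice (s t) (s' t) (-j)
  refine ⟨_, ⟨fun a => ∑ t, algebraMap F[X] F⸨X⸩ (g t a) * u t, ⟨u, fun a => rfl⟩, rfl⟩,
    fun i hi => funext fun a => ?_, fun i hi => funext fun a => ?_⟩
  · simp only [zpowMul, laurentToSeq, hs, HahnSeries.coeff_sum, coeff_algebraMap_mul]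
    exact Finset.sum_congr rfl fun t _ => convCoeff_congr fun m _ hm => hu t m (by omega)
  · simp only [zpowMul, laurentToSeq, hs', HahnSeries.coeff_sum, coeff_algebraMap_mul]
    refine Finset.sum_congr rfl fun t _ => convCoeff_congr fun m hm _ => hu' t m ?_
    have := hd t a
    omega

theorem IsConvolutionalCode.isControllableBehavior_laurentClosure [Finite F]
    {C : Set (Fin n → F⸨X⸩)} (hC : IsConvolutionalCode C) :
    IsControllableBehavior (laurentClosure C) := by
  have hctrl := hC.isControllable.closure
  obtain ⟨S, rfl, -⟩ := hC
  refine ⟨⟨⟨⟨⟨⟨laurentClosure S, ?_⟩, ?_⟩, ?_⟩, rfl⟩, ?_, isCompleteBehavior_closure _⟩, hctrl⟩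
  · intro v w hv hw
    refine mem_closure_iff_forall_Icc.2 fun a b => ?_
    obtain ⟨_, ⟨c, hc, rfl⟩, h⟩ := mem_closure_iff_forall_Icc.1 hv a b
    obtain ⟨_, ⟨c', hc', rfl⟩, h'⟩ := mem_closure_iff_forall_Icc.1 hw a b
    refine ⟨_, ⟨c + c', S.add_mem hc hc', rfl⟩, fun i hi => ?_⟩
    exact congrArg₂ (· + ·) (h i hi) (h' i hi)
  · exact subset_closure ⟨0, S.zero_mem, rfl⟩
  · intro r w hw
    refine mem_closure_iff_forall_Icc.2 fun a b => ?_
    obtain ⟨_, ⟨c, hc, rfl⟩, h⟩ := mem_closure_iff_forall_Icc.1 hw a b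
    refine ⟨_, ⟨HahnSeries.single 0 r • c, S.smul_mem _ hc, rfl⟩, fun i hi => ?_⟩
    have : (r • w : Seq F n) i = r • w i := rfl
    rw [this, ← h i hi]
    funext a
    simp only [laurentToSeq, Pi.smul_apply, smul_eq_mul, HahnSeries.coeff_single_mul, sub_zero]
  · refine isTimeInvariant_iff.2 fun m w hw => mem_closure_iff_forall_Icc.2 fun a b => ?_
    obtain ⟨_, ⟨c, hc, rfl⟩, h⟩ := mem_closure_iff_forall_Icc.1 hw (a + m) (b + m)
    refine ⟨_, ⟨HahnSeries.single (-m) 1 • c, S.smul_mem _ hc, rfl⟩, fun i hi => ?_⟩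
    rw [translate, ← h (i + m) ⟨by have := hi.1; omega, by have := hi.2; omega⟩]
    funext a
    simp only [laurentToSeq, Pi.smul_apply, smul_eq_mul, HahnSeries.coeff_single_mul, one_mul,
      sub_neg_eq_add]

theorem IsBehavior.isConvolutionalCode_laurentPart {B : Set (Seq F n)} (hB : IsBehavior B) :
    IsConvolutionalCode (laurentPart B) := by
  obtain ⟨M, rfl⟩ := hB.exists_eq_seqKernel
  rw [laurentPart_seqKernel]
  exact isConvolutionalCode_laurentKernel M

theorem IsConvolutionalCode.laurentPart_laurentClosure [Finite F] {C : Set (Fin n → F⸨X⸩)}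
    (hC : IsConvolutionalCode C) : laurentPart (laurentClosure C) = C := by
  refine Set.Subset.antisymm ?_ fun c hc => subset_closure ⟨c, hc, rfl⟩
  obtain ⟨M, rfl⟩ := hC.exists_eq_laurentKernel
  have h : laurentClosure (laurentKernel M : Set (Fin n → F⸨X⸩)) ⊆ seqKernel M := by
    refine closure_subset_of_isCompleteBehavior (isCompleteBehavior_seqKernel M)
      (Set.image_subset_iff.2 ?_)
    exact (laurentPart_seqKernel M).ge
  rw [← laurentPart_seqKernel] at h ⊢
  exact Set.preimage_mono h

theorem IsBehavior.laurentClosure_laurentPart_subset [Finite F] {B : Set (Seq F n)}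
    (hB : IsBehavior B) : laurentClosure (laurentPart B) ⊆ B :=
  closure_subset_of_isCompleteBehavior hB.complete (Set.image_preimage_subset _ _)

/-- Steering from the zero trajectory to a given one, earlier and earlier, approximates the latter
by trajectories that vanish in the far past. -/
theorem IsControllableBehavior.subset_laurentClosure_laurentPart [Finite F] {B : Set (Seq F n)}
    (hB : IsControllableBehavior B) : B ⊆ laurentClosure (laurentPart B) := by
  obtain ⟨l, hl⟩ := hB.controllable
  have h0 : (0 : Seq F n) ∈ B := by
    obtain ⟨S, rfl⟩ := hB.linear
    exact S.zero_mem
  refine fun w hw => mem_closure_iff_forall_Icc.2 fun a b => ?_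
  -- With this choice of `j` the steered trajectory agrees with `w` from time `a` on.
  obtain ⟨v, hv, hpast, hfut⟩ := hl 0 h0 w hw (-l - a)
  have hbdd : ∀ c, BddBelow (Function.support fun i => v i c) := fun c => by
    refine ⟨l + a, fun i hi => ?_⟩
    by_contra hlt
    refine hi ?_
    have := congrFun (hpast (i + (-l - a)) (by omega)) c
    simp only [zpowMul, add_sub_cancel_right] at this
    exact this
  have hc : laurentToSeq (fun c => HahnSeries.ofSuppBddBelow _ (hbdd c)) = v := by
    funext i c
    rw [laurentToSeq, HahnSeries.coeff_ofSuppBddBelow]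
  refine ⟨v, ⟨_, ?_, hc⟩, fun i hi => ?_⟩
  · rw [laurentPart, Set.mem_preimage, hc]
    exact hv
  · have := hfut (i - a) (by have := hi.1; omega)
    simp only [zpowMul] at this
    rwa [show i - a - (-l - a + l) = i by ring] at this

theorem laurentClosure_mono {C D : Set (Fin n → F⸨X⸩)} (h : C ⊆ D) :
    laurentClosure C ⊆ laurentClosure D :=
  closure_mono (Set.image_mono h)

end Code

end ConvCode

open ConvCode in
theorem mainTheorem1 (F : Type*) [Field F] [Finite F] (n : ℕ) :
    (∀ B : Set (Seq F n), IsBehavior B →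
      IsConvolutionalCode (laurentPart B) ∧
      IsGreatest {B' : Set (Seq F n) | IsControllableBehavior B' ∧ B' ⊆ B}
        (laurentClosure (laurentPart B))) ∧
    Set.BijOn laurentPart {B : Set (Seq F n) | IsControllableBehavior B}
      {C : Set (Fin n → F⸨X⸩) | IsConvolutionalCode C} ∧
    Set.InvOn laurentClosure laurentPart {B : Set (Seq F n) | IsControllableBehavior B}
      {C : Set (Fin n → F⸨X⸩) | IsConvolutionalCode C} := by
  have hinv : Set.InvOn laurentClosure laurentPart {B : Set (Seq F n) | IsControllableBehavior B}
      {C : Set (Fin n → F⸨X⸩) | IsConvolutionalCode C} :=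
    ⟨fun B hB => (hB.toIsBehavior.laurentClosure_laurentPart_subset).antisymm
      hB.subset_laurentClosure_laurentPart, fun C hC => hC.laurentPart_laurentClosure⟩
  refine ⟨fun B hB => ⟨hB.isConvolutionalCode_laurentPart,
    ⟨hB.isConvolutionalCode_laurentPart.isControllableBehavior_laurentClosure,
      hB.laurentClosure_laurentPart_subset⟩, fun B' hB' => ?_⟩, hinv.bijOn ?_ ?_, hinv⟩
  · exact hB'.1.subset_laurentClosure_laurentPart.trans
      (laurentClosure_mono (Set.preimage_mono hB'.2))
  · exact fun B hB => hB.toIsBehavior.isConvolutionalCode_laurentPart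
  · exact fun C hC => hC.isControllableBehavior_laurentClosure
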